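/- **Setting.** A Cantor space is a non-empty compact totally disconnected metric space without isolated points. A (finitely generated) *pseudogroup action* $\Phi$ on a Cantor space $\mathfrak X$ is given by a finite partition $\mathfrak X=\mathfrak T_1\sqcup\dots\sqcup\mathfrak T_\nu$ into clopen sets, a reflexive and symmetric set of *admissible* pairs $(i,j)$, and, for each admissible pair, a non-empty clopen set $\mathfrak D_{i,j}\subset\mathfrak T_i$ and a homeomorphism $h_{j,i}\colon\mathfrak D_{i,j}\to\mathfrak D_{j,i}$, with $h_{i,j}=h_{j,i}^{-1}$ and $h_{i,i}=\mathrm{id}_{\mathfrak T_i}$. A sequence $\mathcal I=(i_0,\dots,i_\alpha)$, $\alpha\ge1$, is admissible if consecutive pairs are admissible and $h_{\mathcal I}=h_{i_\alpha,i_{\alpha-1}}\circ\dots\circ h_{i_1,i_0}$ has non-empty (maximal) domain. Let $\mathcal G^*$ be the set of all restrictions of the maps $h_{\mathcal I}$ to open subsets of their domains, and for $W\subset\mathfrak X$ let $\mathcal G^*_W$ be the set of $g\in\mathcal G^*$ with domain and range contained in $W$. * $\Phi$ is *minimal* if for every $w$ the orbit $\{g(w): g\in\mathcal G^*,\ w\in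 \mathrm{Dom}(g)\}$ is dense in $\mathfrak X$. * $\Phi$ is *equicontinuous* if for every $\epsilon>0$ there is $\delta>0$ such that for all $g\in\mathcal G^*$ and $w,w'\in\mathrm{Dom}(g)$, $d(w,w')<\delta$ implies $d(g(w),g(w'))<\epsilon$. * Pseudogroup actions $\Phi_1$ on $\mathfrak X_1$ and $\Phi_2$ on $\mathfrak X_2$ are *return equivalent* if there are non-empty open sets $U_i\subset\mathfrak X_i$ and a homeomorphism $\phi\colon U_1\to U_2$ such that $g\mapsto\phi\circ g\circ\phi^{-1}$ maps $(\mathcal G_1^*)_{U_1}$ into $(\mathcal G_2^*)_{U_2}$ and $h\mapsto\phi^{-1}\circ h\circ\phi$ maps $(\mathcal G_2^*)_{U_2}$ into $(\mathcal G_1^*)_{U_1}$. * A non-empty clopen set $U$ is *adapted*, with group $\mathcal H_U$, if $\mathcal H_U$ is a subgroup of $\mathrm{Homeo}(U)$ and $\mathcal G^*_U$ is exactly the set of restrictions of elements of $\mathcal H_U$ to open subsets of $U$. (The group $\mathcal H_U$ is then determined by $U$.) For adapted $V\subset U$ let $\mathcal H_{U,V}=\{g\in\mathcal H_U: g(V)=V\}$.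 Closures $\overline{\mathcal H_{U,V}}\subset\mathrm{Homeo}(U)$ and $\overline{\mathcal H_V}\subset\mathrm{Homeo}(V)$ are taken in the uniform topology. * $\Phi$ is *stable* if every $x\in\mathfrak X$ lies in an adapted clopen set $U$ such that for every adapted clopen set $V\subset U$ the restriction homomorphism $\overline{\mathcal H_{U,V}}\to\overline{\mathcal H_V}$ has trivial kernel, that is, the only $\widehat g\in\overline{\mathcal H_{U,V}}$ with $\widehat g|_V=\mathrm{id}_V$ is $\mathrm{id}_U$. * $\Phi$ is *LCSQA* (locally completely strongly quasi-analytic) if every $x\in\mathfrak X$ has an open neighbourhood $U$ such that, for every open set $O$ and every map $\widehat g\colon O\to\mathfrak X$ in the closure, in the compact-open topology on the continuous maps $O\to\mathfrak X$, of the set of elements of $\mathcal G^*_U$ with domain $O$: if $\widehat g$ is the identity on some non-empty open set $V\subset O\cap U$, then $\widehat g$ is the identity on $O$. **Proposition.** Let $\Phi_1$ and $\Phi_2$ be equicontinuous minimal pseudogroup actions on Cantor spaces $\mathfrak X_1$ and $\mathfrak X_2$, and assume that $\Phi_1$ and $\Phi_2$ are return equivalent. Then $\Phi_1$ is stable if and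 only if $\Phi_2$ is stable, and $\Phi_1$ is LCSQA if and only if $\Phi_2$ is LCSQA. Moreover, for each $i=1,2$, $\Phi_i$ is stable if and only if it is LCSQA. -/

import Mathlib

/-- A finitely generated pseudogroup action on a space `X`, presented by its generators: a finite
partition of `X` into clopen sets `T i`, a relation `Adm i j` of admissibility on the indices, and
for each admissible pair `(i, j)` a homeomorphism `gen i j` from a nonempty clopen subset
`D i j` of `T i` (its source) onto a clopen subset `D j i` of `T j` (its target),
such that `gen i i` is the identity of `T i` and `gen j i` is the inverse of `gen i j`.
The values of `gen` at pairs that are not admissible play no role. -/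
structure PseudogroupAction (X : Type*) [TopologicalSpace X] where
  ν : ℕ
  T : Fin ν → Set X
  isClopen_T : ∀ i, IsClopen (T i)
  disjoint_T : Pairwise fun i j => Disjoint (T i) (T j)
  cover_T : ⋃ i, T i = Set.univ
  Adm : Fin ν → Fin ν → Prop
  adm_refl : ∀ i, Adm i i
  adm_symm : ∀ i j, Adm i j → Adm j i
  gen : Fin ν → Fin ν → OpenPartialHomeomorph X X
  isClopen_source : ∀ i j, Adm i j → IsClopen (gen i j).source
  source_nonempty : ∀ i j, Adm i j → (gen i j).source.Nonempty
  source_subset : ∀ i j, Adm i j → (gen i j).source ⊆ T i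
  source_self : ∀ i, (gen i i).source = T i
  gen_self : ∀ i, ∀ x ∈ T i, gen i i x = x
  gen_symm : ∀ i j, Adm i j → gen j i ≈ (gen i j).symm

namespace PseudogroupAction

section General

variable {X : Type*} [TopologicalSpace X] (Φ : PseudogroupAction X)

/-- The composition `h_I` of the generators along the sequence `I = (i, l₁, …, l_α)`
(first `gen i l₁`, then `gen l₁ l₂`, and so on), on its maximal domain. -/
def hol : Fin Φ.ν → List (Fin Φ.ν) → OpenPartialHomeomorph X X
  | _, [] => OpenPartialHomeomorph.refl X
  | i, j :: l => (Φ.gen i j).trans (hol j l)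

/-- The sequence `(i, l₁, …, l_α)`, `α ≥ 1`, is admissible: consecutive pairs are admissible and
the composition along it has nonempty domain. -/
def AdmissibleSeq (i : Fin Φ.ν) (l : List (Fin Φ.ν)) : Prop :=
  l ≠ [] ∧ List.IsChain Φ.Adm (i :: l) ∧ (Φ.hol i l).source.Nonempty

/-- The pseudo-star-group `𝒢*`: all restrictions of the maps `h_I`, for `I` an admissible sequence,
to open subsets of their domains. A partial homeomorphism matters only through its source and
its values there. -/
def pseudoStar : Set (OpenPartialHomeomorph X X) :=
  {g | ∃ i l, Φ.AdmissibleSeq i l ∧ g.source ⊆ (Φ.hol i l).source ∧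
    Set.EqOn g (Φ.hol i l) g.source}

/-- The pseudo-star-group `𝒢*_W` induced on `W`: the elements of `𝒢*` with domain and range
in `W`. -/
def induced (W : Set X) : Set (OpenPartialHomeomorph X X) :=
  {g | g ∈ Φ.pseudoStar ∧ g.source ⊆ W ∧ g.target ⊆ W}

/-- The orbit of a point. -/
def orbit (w : X) : Set X :=
  {y | ∃ g ∈ Φ.pseudoStar, w ∈ g.source ∧ g w = y}

/-- The action is minimal if every orbit is dense. -/
def IsMinimal : Prop := ∀ w, Dense (Φ.orbit w)

/-- The clopen (nonempty) set `U` is adapted to the action, with group `H ⊆ Homeo(U)`: the induced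
pseudo-star-group `𝒢*_U` consists exactly of the restrictions of the elements of `H` to open
subsets of `U`. The group `H` is then determined by `U`. -/
def IsAdapted (U : Set X) (H : Subgroup (U ≃ₜ U)) : Prop :=
  IsClopen U ∧ U.Nonempty ∧
    ∀ g : OpenPartialHomeomorph X X, g ∈ Φ.induced U ↔
      ∃ hU : g.source ⊆ U, ∃ h ∈ H, ∀ x (hx : x ∈ g.source), g x = h ⟨x, hU hx⟩

/-- For an open set `O`, the maps `O → X` that belong to the closure of `𝒢*_U`: the closure, in the
compact-open topology of `C(O, X)`, of the set of elements of `𝒢*_U` with domain `O`. -/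
def inducedClosure (U O : Set X) : Set C(O, X) :=
  closure {f : C(O, X) | ∃ g ∈ Φ.induced U, g.source = O ∧ ∀ x : O, f x = g x}

/-- The locally completely strongly quasi-analytic (LCSQA) property: every point has an open
neighborhood `U` such that each element of the closure of `𝒢*_U` which is the identity on some
nonempty open subset of its domain is the identity on its domain. -/
def IsLCSQA : Prop :=
  ∀ x : X, ∃ U : Set X, IsOpen U ∧ x ∈ U ∧
    ∀ O : Set X, IsOpen O → ∀ f ∈ Φ.inducedClosure U O,
      (∃ V : Set X, IsOpen V ∧ V.Nonempty ∧ V ⊆ O ∩ U ∧ ∀ y : O, (y : X) ∈ V → f y = y) →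
        ∀ y : O, f y = y

end General

section Metric

variable {X : Type*} [MetricSpace X] (Φ : PseudogroupAction X)

/-- Equicontinuity of the action: the elements of `𝒢*` are uniformly equicontinuous. -/
def IsEquicontinuous : Prop :=
  ∀ ε > 0, ∃ δ > 0, ∀ g ∈ Φ.pseudoStar, ∀ w ∈ g.source, ∀ w' ∈ g.source,
    dist w w' < δ → dist (g w) (g w') < ε

end Metric

/-- The subgroup `H_{U,V}` of the elements `g` of `H ⊆ Homeo(U)` with `g(V) = V`. -/
def setStabilizer {X : Type*} [TopologicalSpace X] {U : Set X} (H : Subgroup (U ≃ₜ U))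
    (V : Set X) : Set (U ≃ₜ U) :=
  {g | g ∈ H ∧ g '' {u : U | (u : X) ∈ V} = {u : U | (u : X) ∈ V}}

/-- The closure of a set of homeomorphisms of `Y` in `Homeo(Y)`, in the uniform topology on
maps. -/
def uniformClosure {Y : Type*} [MetricSpace Y] (S : Set (Y ≃ₜ Y)) : Set (Y ≃ₜ Y) :=
  {f | ∀ ε > 0, ∃ g ∈ S, ∀ y, dist (f y) (g y) < ε}

/-- The action is stable: every point `x` lies in an adapted clopen set `U`, with group `H_U`, such
that for every adapted clopen set `V ⊆ U`, with group `H_V`, the homomorphism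
`closure H_{U,V} → closure H_V` given by restriction to `V` has trivial kernel; that is, the only
element of `closure H_{U,V}` whose restriction to `V` is the identity is the identity of `U`. -/
def IsStable {X : Type*} [MetricSpace X] (Φ : PseudogroupAction X) : Prop :=
  ∀ x : X, ∃ (U : Set X) (HU : Subgroup (U ≃ₜ U)), Φ.IsAdapted U HU ∧ x ∈ U ∧
    ∀ (V : Set X) (HV : Subgroup (V ≃ₜ V)), Φ.IsAdapted V HV → V ⊆ U →
      ∀ g ∈ uniformClosure (setStabilizer HU V), (∀ u : U, (u : X) ∈ V → g u = u) → g = 1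

/-- Two actions are return equivalent if there are nonempty open sets `U₁ ⊆ X₁` and `U₂ ⊆ X₂`, the
source and the target of `φ`, and a homeomorphism `φ : U₁ → U₂` such that `g ↦ φ ∘ g ∘ φ⁻¹` maps
`𝒢*_{U₁}` into `𝒢*_{U₂}` and `h ↦ φ⁻¹ ∘ h ∘ φ` maps `𝒢*_{U₂}` into `𝒢*_{U₁}`. -/
def ReturnEquivalent {X₁ X₂ : Type*} [TopologicalSpace X₁] [TopologicalSpace X₂]
    (Φ₁ : PseudogroupAction X₁) (Φ₂ : PseudogroupAction X₂) : Prop :=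
  ∃ φ : OpenPartialHomeomorph X₁ X₂, φ.source.Nonempty ∧
    (∀ g ∈ Φ₁.induced φ.source, (φ.symm.trans g).trans φ ∈ Φ₂.induced φ.target) ∧
    (∀ h ∈ Φ₂.induced φ.target, (φ.trans h).trans φ.symm ∈ Φ₁.induced φ.source)

end PseudogroupAction

/-! Stability and LCSQA are both shown equivalent, for an equicontinuous action, to local rigidity
(`IsLocallyRigid`): near each point, an element of `𝒢*_U` that is almost the identity on a given
open set is almost the identity on its whole domain. This condition involves neither closures nor
adapted sets, so it is easy to transport.

The cycle is stable ⇒ locally rigid (`IsStable.isLocallyRigid`, by Arzelà–Ascoli) ⇒ LCSQA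
(`IsLocallyRigid.isLCSQA`, by approximation) ⇒ stable (`IsLCSQA.isStable`). It needs arbitrarily
small adapted sets. By equicontinuity, points closer than a uniform δ have the same itineraries
under all compositions of generators; the classes of points with equal itineraries are clopen and
adapted (`IsEquicontinuous.exists_isBlock`).

Finally, minimality moves any point into the region where the return equivalence is defined, and
conjugation carries rigidity across (`IsLocallyRigid.of_returnEquivalent`). -/

open Set Filter Topology

namespace PseudogroupAction

/-! ### Compositions of generators, blocks and itineraries. -/

section Paths

variable {X : Type*} [TopologicalSpace X] (Φ : PseudogroupAction X)

/-- `Φ.IsPath i j p`: `p` is the composition of the generators, on its maximal domain, along a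
sequence of at least two indices from `i` to `j` whose consecutive pairs are admissible. -/
inductive IsPath : Fin Φ.ν → Fin Φ.ν → OpenPartialHomeomorph X X → Prop
  | gen {i j : Fin Φ.ν} : Φ.Adm i j → IsPath i j (Φ.gen i j)
  | cons {i j k : Fin Φ.ν} {p : OpenPartialHomeomorph X X} :
      Φ.Adm i j → IsPath j k p → IsPath i k ((Φ.gen i j).trans p)

variable {Φ}

theorem IsPath.exists_hol {i j : Fin Φ.ν} {p : OpenPartialHomeomorph X X} (hp : Φ.IsPath i j p) :
    ∃ l, l ≠ [] ∧ List.IsChain Φ.Adm (i :: l) ∧ Φ.hol i l = p := by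
  induction hp with
  | @gen i j h => exact ⟨[j], by simp, by simpa using h, by simp [hol]⟩
  | @cons i j k p h _ ih =>
    obtain ⟨l, -, hl, rfl⟩ := ih
    exact ⟨j :: l, by simp, List.isChain_cons_cons.2 ⟨h, hl⟩, rfl⟩

theorem exists_isPath_hol {i : Fin Φ.ν} {l : List (Fin Φ.ν)} (hl : l ≠ [])
    (hc : List.IsChain Φ.Adm (i :: l)) : ∃ j, Φ.IsPath i j (Φ.hol i l) := by
  induction l generalizing i with
  | nil => exact absurd rfl hl
  | cons j l ih =>
    obtain ⟨h, hc⟩ := List.isChain_cons_cons.1 hc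
    rcases eq_or_ne l [] with rfl | hl
    · exact ⟨j, by simpa [hol] using IsPath.gen h⟩
    · obtain ⟨k, hk⟩ := ih hl hc
      exact ⟨k, .cons h hk⟩

theorem IsPath.trans {i j k : Fin Φ.ν} {p q : OpenPartialHomeomorph X X} (hp : Φ.IsPath i j p)
    (hq : Φ.IsPath j k q) : Φ.IsPath i k (p.trans q) := by
  induction hp with
  | gen h => exact .cons h hq
  | cons h _ ih =>
    rw [OpenPartialHomeomorph.trans_assoc]
    exact .cons h (ih hq)

theorem IsPath.exists_symm {i j : Fin Φ.ν} {p : OpenPartialHomeomorph X X}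
    (hp : Φ.IsPath i j p) : ∃ q, Φ.IsPath j i q ∧ q ≈ p.symm := by
  induction hp with
  | @gen i j h => exact ⟨_, .gen (Φ.adm_symm _ _ h), Φ.gen_symm _ _ h⟩
  | @cons i j k p h _ ih =>
    obtain ⟨q, hq, hqp⟩ := ih
    refine ⟨_, hq.trans (.gen (Φ.adm_symm _ _ h)), ?_⟩
    rw [OpenPartialHomeomorph.trans_symm_eq_symm_trans_symm]
    exact OpenPartialHomeomorph.EqOnSource.trans' hqp (Φ.gen_symm _ _ h)

theorem IsPath.source_subset {i j : Fin Φ.ν} {p : OpenPartialHomeomorph X X}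
    (hp : Φ.IsPath i j p) : p.source ⊆ Φ.T i := by
  cases hp with
  | gen h => exact Φ.source_subset _ _ h
  | cons h _ => exact fun x hx => Φ.source_subset _ _ h hx.1

theorem IsPath.target_subset {i j : Fin Φ.ν} {p : OpenPartialHomeomorph X X}
    (hp : Φ.IsPath i j p) : p.target ⊆ Φ.T j := by
  obtain ⟨q, hq, hqp⟩ := hp.exists_symm
  have := hq.source_subset
  rwa [hqp.source_eq] at this

theorem eq_of_mem_T {i j : Fin Φ.ν} {x : X} (hi : x ∈ Φ.T i) (hj : x ∈ Φ.T j) : i = j := by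
  by_contra h
  exact Set.disjoint_left.1 (Φ.disjoint_T h) hi hj

theorem exists_mem_T (Φ : PseudogroupAction X) (x : X) : ∃ i, x ∈ Φ.T i := by
  have : x ∈ ⋃ i, Φ.T i := Φ.cover_T ▸ mem_univ x
  simpa using this

theorem mem_pseudoStar_iff {g : OpenPartialHomeomorph X X} :
    g ∈ Φ.pseudoStar ↔ ∃ i j p, Φ.IsPath i j p ∧ p.source.Nonempty ∧ g.source ⊆ p.source ∧
      EqOn g p g.source := by
  constructor
  · rintro ⟨i, l, ⟨hl, hc, hn⟩, hs, he⟩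
    obtain ⟨j, hj⟩ := exists_isPath_hol hl hc
    exact ⟨i, j, _, hj, hn, hs, he⟩
  · rintro ⟨i, j, p, hp, hn, hs, he⟩
    obtain ⟨l, hl, hc, rfl⟩ := hp.exists_hol
    exact ⟨i, l, ⟨hl, hc, hn⟩, hs, he⟩

theorem IsPath.mem_pseudoStar {i j : Fin Φ.ν} {p : OpenPartialHomeomorph X X}
    (hp : Φ.IsPath i j p) (hn : p.source.Nonempty) : p ∈ Φ.pseudoStar :=
  mem_pseudoStar_iff.2 ⟨i, j, p, hp, hn, Subset.rfl, fun _ _ => rfl⟩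

theorem mem_pseudoStar_of_eqOn {g g' : OpenPartialHomeomorph X X} (hg : g ∈ Φ.pseudoStar)
    (hs : g'.source ⊆ g.source) (he : EqOn g' g g'.source) : g' ∈ Φ.pseudoStar := by
  obtain ⟨i, l, h, hgs, hge⟩ := hg
  exact ⟨i, l, h, hs.trans hgs, fun x hx => (he hx).trans (hge (hs hx))⟩

theorem trans_mem_pseudoStar {g g' : OpenPartialHomeomorph X X} (hg : g ∈ Φ.pseudoStar)
    (hg' : g' ∈ Φ.pseudoStar) : g.trans g' ∈ Φ.pseudoStar := by
  rcases (g.trans g').source.eq_empty_or_nonempty with h | ⟨x, hx⟩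
  -- If the composite is empty, the two paths need not be composable, so it is taken as an empty
  -- restriction of `g`.
  · exact mem_pseudoStar_of_eqOn hg (h ▸ empty_subset _) (h ▸ eqOn_empty _ _)
  obtain ⟨i, j, p, hp, -, hs, he⟩ := mem_pseudoStar_iff.1 hg
  obtain ⟨i', j', p', hp', -, hs', he'⟩ := mem_pseudoStar_iff.1 hg'
  have key : ∀ y ∈ (g.trans g').source, y ∈ (p.trans p').source := fun y hy =>
    ⟨hs hy.1, show p y ∈ p'.source from he hy.1 ▸ hs' hy.2⟩
  obtain rfl : j = i' := eq_of_mem_T (hp.target_subset (p.map_source (key x hx).1))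
    (hp'.source_subset (key x hx).2)
  refine mem_pseudoStar_iff.2 ⟨i, j', _, hp.trans hp', ⟨x, key x hx⟩, key, fun y hy => ?_⟩
  change g' (g y) = p' (p y)
  rw [← he hy.1]
  exact he' hy.2

theorem symm_mem_pseudoStar {g : OpenPartialHomeomorph X X} (hg : g ∈ Φ.pseudoStar) :
    g.symm ∈ Φ.pseudoStar := by
  obtain ⟨i, j, p, hp, ⟨x, hx⟩, hs, he⟩ := mem_pseudoStar_iff.1 hg
  obtain ⟨q, hq, hqp⟩ := hp.exists_symm
  have hmem : ∀ y ∈ g.target, p (g.symm y) = y := fun y hy => by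
    rw [← he (g.map_target hy), g.right_inv hy]
  have hqs : q.source = p.target := hqp.source_eq
  have key : ∀ y ∈ g.target, y ∈ p.target := fun y hy =>
    hmem y hy ▸ p.map_source (hs (g.map_target hy))
  refine mem_pseudoStar_iff.2 ⟨j, i, q, hq, ⟨p x, hqs ▸ p.map_source hx⟩,
    fun y hy => hqs ▸ key y hy, fun y hy => ?_⟩
  rw [hqp.eqOn (hqs ▸ key y hy)]
  conv_rhs => rw [← hmem y hy]
  exact (p.left_inv (hs (g.map_target hy))).symm

/-- A nonempty clopen subset of one of the sets of the partition is a block if every composition of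
generators that maps one of its points into it is defined on it and maps it onto itself. -/
structure IsBlock (Φ : PseudogroupAction X) (U : Set X) : Prop where
  isClopen : IsClopen U
  nonempty : U.Nonempty
  exists_subset_T : ∃ i, U ⊆ Φ.T i
  subset_source : ∀ {i j p w}, Φ.IsPath i j p → w ∈ U → w ∈ p.source → p w ∈ U → U ⊆ p.source
  image_eq : ∀ {i j p w}, Φ.IsPath i j p → w ∈ U → w ∈ p.source → p w ∈ U → p '' U = U

theorem gen_self_mem_pseudoStar (Φ : PseudogroupAction X) (i : Fin Φ.ν) :
    Φ.gen i i ∈ Φ.pseudoStar :=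
  (IsPath.gen (Φ.adm_refl i)).mem_pseudoStar (Φ.source_nonempty i i (Φ.adm_refl i))

/-- The group of a block. -/
def IsBlock.group {U : Set X} (hU : Φ.IsBlock U) : Subgroup (U ≃ₜ U) where
  carrier := {h | ∃ g ∈ Φ.pseudoStar, g.source = U ∧ ∀ x : U, g x = h x}
  mul_mem' := by
    rintro a b ⟨g, hg, hgs, hga⟩ ⟨g', hg', hgs', hgb⟩
    refine ⟨g'.trans g, trans_mem_pseudoStar hg' hg, ?_, fun x => ?_⟩
    · ext x
      rw [OpenPartialHomeomorph.trans_source, hgs, hgs']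
      exact ⟨fun h => h.1, fun h => ⟨h, show g' x ∈ U from hgb ⟨x, h⟩ ▸ (b ⟨x, h⟩).2⟩⟩
    · change g (g' x) = _
      rw [hgb, hga]
      rfl
  one_mem' := by
    obtain ⟨i, hi⟩ := hU.exists_subset_T
    refine ⟨(Φ.gen i i).restrOpen U hU.isClopen.isOpen,
      mem_pseudoStar_of_eqOn (Φ.gen_self_mem_pseudoStar i) (fun x hx => hx.1)
        (fun x hx => rfl), ?_, fun x => ?_⟩
    · rw [OpenPartialHomeomorph.restrOpen_source, Φ.source_self]
      exact inter_eq_right.2 hi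
    · exact Φ.gen_self i x (hi x.2)
  inv_mem' := by
    rintro a ⟨g, hg, hgs, hga⟩
    have ht : ∀ y : U, g (a.symm y) = y := fun y => by rw [hga]; simp
    refine ⟨g.symm, symm_mem_pseudoStar hg, ?_, fun y => ?_⟩
    · ext y
      rw [OpenPartialHomeomorph.symm_source, ← g.image_source_eq_target, hgs]
      constructor
      · rintro ⟨x, hx, rfl⟩
        exact hga ⟨x, hx⟩ ▸ (a ⟨x, hx⟩).2
      · exact fun hy => ⟨a.symm ⟨y, hy⟩, (a.symm ⟨y, hy⟩).2, ht ⟨y, hy⟩⟩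
    · have := g.left_inv (x := a.symm y) (hgs ▸ (a.symm y).2)
      rw [ht] at this
      exact this

/-- An element of `𝒢*_U` at one point of its domain determines a path returning that point to `U`;
the block property extends this path to a homeomorphism of all of `U`. -/
theorem IsBlock.isAdapted {U : Set X} (hU : Φ.IsBlock U) : Φ.IsAdapted U hU.group := by
  refine ⟨hU.isClopen, hU.nonempty, fun g => ⟨?_, ?_⟩⟩
  · rintro ⟨hg, hs, ht⟩
    refine ⟨hs, ?_⟩
    rcases g.source.eq_empty_or_nonempty with h | ⟨w, hw⟩
    · exact ⟨1, one_mem _, fun x hx => by simp [h] at hx⟩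
    obtain ⟨i, j, p, hp, hn, hgs, hge⟩ := mem_pseudoStar_iff.1 hg
    have hpw : p w ∈ U := hge hw ▸ ht (g.map_source hw)
    have hUp := hU.subset_source hp (hs hw) (hgs hw) hpw
    refine ⟨p.homeomorphOfImageSubsetSource hUp (hU.image_eq hp (hs hw) (hgs hw) hpw),
      ⟨p.restrOpen U hU.isClopen.isOpen,
        mem_pseudoStar_of_eqOn (hp.mem_pseudoStar hn) (fun x hx => hx.1) (fun x hx => rfl),
        inter_eq_right.2 hUp, fun x => rfl⟩, fun x hx => hge hx⟩
  · rintro ⟨hs, h, ⟨k, hk, hks, hkh⟩, hgh⟩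
    have hgk : EqOn g k g.source := fun x hx => by rw [hgh x hx, ← hkh]
    refine ⟨mem_pseudoStar_of_eqOn hk (hks ▸ hs) hgk, hs, ?_⟩
    rw [← g.image_source_eq_target]
    rintro _ ⟨x, hx, rfl⟩
    exact hgh x hx ▸ (h _).2

/-- Two points are related if the same compositions of generators are defined at both, and map both
or neither into `W`. -/
def SameCode (Φ : PseudogroupAction X) (W : Set X) (w w' : X) : Prop :=
  ∀ i j p, Φ.IsPath i j p → (w ∈ p.source ↔ w' ∈ p.source) ∧
    (w ∈ p.source → (p w ∈ W ↔ p w' ∈ W))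

theorem SameCode.refl (Φ : PseudogroupAction X) (W : Set X) (w : X) : Φ.SameCode W w w :=
  fun _ _ _ _ => ⟨Iff.rfl, fun _ => Iff.rfl⟩

theorem SameCode.symm {W : Set X} {w w' : X} (h : Φ.SameCode W w w') : Φ.SameCode W w' w :=
  fun i j p hp => ⟨(h i j p hp).1.symm, fun hw => ((h i j p hp).2 ((h i j p hp).1.2 hw)).symm⟩

theorem SameCode.trans {W : Set X} {w w' w'' : X} (h : Φ.SameCode W w w')
    (h' : Φ.SameCode W w' w'') : Φ.SameCode W w w'' :=
  fun i j p hp => ⟨(h i j p hp).1.trans (h' i j p hp).1, fun hw =>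
    ((h i j p hp).2 hw).trans ((h' i j p hp).2 ((h i j p hp).1.1 hw))⟩

theorem SameCode.mem_T {W : Set X} {w w' : X} (h : Φ.SameCode W w w') {i : Fin Φ.ν}
    (hw : w ∈ Φ.T i) : w' ∈ Φ.T i := by
  have := (h i i _ (.gen (Φ.adm_refl i))).1
  rw [Φ.source_self] at this
  exact this.1 hw

theorem SameCode.mem {W : Set X} {w w' : X} (h : Φ.SameCode W w w') (hw : w ∈ W) : w' ∈ W := by
  obtain ⟨i, hi⟩ := Φ.exists_mem_T w
  have := (h i i _ (.gen (Φ.adm_refl i))).2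
  rw [Φ.source_self, Φ.gen_self i w hi, Φ.gen_self i w' (h.mem_T hi)] at this
  exact (this hi).1 hw

theorem SameCode.map {W : Set X} {w w' : X} (h : Φ.SameCode W w w') {i j : Fin Φ.ν}
    {p : OpenPartialHomeomorph X X} (hp : Φ.IsPath i j p) (hw : w ∈ p.source) :
    Φ.SameCode W (p w) (p w') := by
  have hw' := (h i j p hp).1.1 hw
  intro i' k q hq
  by_cases hj : j = i'
  · subst hj
    have := h i k _ (hp.trans hq)
    refine ⟨⟨fun hx => (this.1.1 ⟨hw, hx⟩).2, fun hx => (this.1.2 ⟨hw', hx⟩).2⟩,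
      fun hx => this.2 ⟨hw, hx⟩⟩
  · have h1 : p w ∉ q.source := fun hx =>
      hj (eq_of_mem_T (hp.target_subset (p.map_source hw)) (hq.source_subset hx))
    have h2 : p w' ∉ q.source := fun hx =>
      hj (eq_of_mem_T (hp.target_subset (p.map_source hw')) (hq.source_subset hx))
    exact ⟨⟨fun hx => absurd hx h1, fun hx => absurd hx h2⟩, fun hx => absurd hx h1⟩

end Paths

/-! ### Equicontinuity yields arbitrarily small blocks. -/

section SmallBlocks

variable {X : Type*} [MetricSpace X] [CompactSpace X] {Φ : PseudogroupAction X}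

theorem exists_pos_forall_dist_lt_mem {S : Set X} (hS : IsClopen S) :
    ∃ r > 0, ∀ x ∈ S, ∀ y, dist x y < r → y ∈ S := by
  obtain ⟨r, hr, h⟩ := hS.isClosed.isCompact.exists_thickening_subset_open hS.isOpen Subset.rfl
  exact ⟨r, hr, fun x hx y hxy => h (Metric.mem_thickening_iff.2 ⟨x, hx, dist_comm x y ▸ hxy⟩)⟩

theorem exists_pos_forall_mem_gen_source (Φ : PseudogroupAction X) :
    ∃ r > 0, ∀ i j, Φ.Adm i j → ∀ x ∈ (Φ.gen i j).source, ∀ y, dist x y < r →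
      y ∈ (Φ.gen i j).source := by
  have : ∀ ij : Fin Φ.ν × Fin Φ.ν, ∀ᶠ r in 𝓝[>] (0 : ℝ), Φ.Adm ij.1 ij.2 →
      ∀ x ∈ (Φ.gen ij.1 ij.2).source, ∀ y, dist x y < r → y ∈ (Φ.gen ij.1 ij.2).source := by
    rintro ⟨i, j⟩
    by_cases h : Φ.Adm i j
    · obtain ⟨r, hr, hr'⟩ := exists_pos_forall_dist_lt_mem (Φ.isClopen_source i j h)
      filter_upwards [Ioo_mem_nhdsGT hr] with s hs _ x hx y hxy
      exact hr' x hx y (hxy.trans hs.2)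
    · exact Eventually.of_forall fun r h' => absurd h' h
  obtain ⟨r, h, hr⟩ := ((eventually_all.2 this).and self_mem_nhdsWithin).exists
  exact ⟨r, hr, fun i j => h (i, j)⟩

/-- The radius does not shrink with the length of the path: equicontinuity is applied each time to
the whole initial segment `g`, whose values at the two points stay within the common radius `r` for
the finitely many generators. -/
theorem IsEquicontinuous.exists_pos_forall_mem_source (hΦ : Φ.IsEquicontinuous) :
    ∃ δ > 0, ∀ i j p, Φ.IsPath i j p → ∀ w ∈ p.source, ∀ w', dist w w' < δ → w' ∈ p.source := by
  obtain ⟨r, hr, hgen⟩ := Φ.exists_pos_forall_mem_gen_source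
  obtain ⟨δ, hδ, heq⟩ := hΦ r hr
  -- The bound `r` puts `w'` in the same piece `T i` as `w`, so that the induction can start from
  -- `gen i i`.
  refine ⟨min δ r, lt_min hδ hr, ?_⟩
  have key : ∀ i j p, Φ.IsPath i j p → ∀ g ∈ Φ.pseudoStar, ∀ w ∈ g.source, ∀ w' ∈ g.source,
      dist w w' < δ → g w ∈ p.source → g w' ∈ p.source := by
    intro i j p hp
    induction hp with
    | gen h => exact fun g hg w hw w' hw' hd hgw => hgen _ _ h _ hgw _ (heq g hg w hw w' hw' hd)
    | @cons i j k p h hp ih =>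
      intro g hg w hw w' hw' hd hgw
      have h1 := hgen _ _ h _ hgw.1 _ (heq g hg w hw w' hw' hd)
      exact ⟨h1, ih _ (trans_mem_pseudoStar hg ((IsPath.gen h).mem_pseudoStar ⟨_, h1⟩))
        w ⟨hw, hgw.1⟩ w' ⟨hw', h1⟩ hd hgw.2⟩
  intro i j p hp w hw w' hd
  have hwi := hp.source_subset hw
  have hwi' : w' ∈ (Φ.gen i i).source :=
    hgen i i (Φ.adm_refl i) w (by rwa [Φ.source_self]) w' (hd.trans_le (min_le_right _ _))
  have := key i j p hp _ (Φ.gen_self_mem_pseudoStar i) w (by rwa [Φ.source_self]) w' hwi'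
    (hd.trans_le (min_le_left _ _))
  rw [Φ.source_self] at hwi'
  rw [Φ.gen_self i w hwi, Φ.gen_self i w' hwi'] at this
  exact this hw

theorem IsEquicontinuous.exists_pos_forall_sameCode (hΦ : Φ.IsEquicontinuous) {W : Set X}
    (hW : IsClopen W) : ∃ δ > 0, ∀ w w', dist w w' < δ → Φ.SameCode W w w' := by
  obtain ⟨δ₁, hδ₁, hdom⟩ := hΦ.exists_pos_forall_mem_source
  obtain ⟨r, hr, hWr⟩ := exists_pos_forall_dist_lt_mem hW
  obtain ⟨δ₂, hδ₂, heq⟩ := hΦ r hr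
  refine ⟨min δ₁ δ₂, lt_min hδ₁ hδ₂, fun w w' hd i j p hp => ?_⟩
  have h1 := hd.trans_le (min_le_left _ _)
  have h2 := hd.trans_le (min_le_right _ _)
  refine ⟨⟨fun hw => hdom i j p hp w hw w' h1, fun hw => hdom i j p hp w' hw w (dist_comm w w' ▸ h1)⟩,
    fun hw => ?_⟩
  have hw' := hdom i j p hp w hw w' h1
  have h3 := heq p (hp.mem_pseudoStar ⟨w, hw⟩) w hw w' hw' h2
  exact ⟨fun h => hWr _ h _ h3, fun h => hWr _ h _ (dist_comm (p w) (p w') ▸ h3)⟩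

/-- The block is the `SameCode` class of `x` for a clopen `W` with `x ∈ W ⊆ O`. Paths carry classes
into classes; applying this to the inverse path gives surjectivity. -/
theorem IsEquicontinuous.exists_isBlock [TotallyDisconnectedSpace X] (hΦ : Φ.IsEquicontinuous)
    {x : X} {O : Set X} (hO : IsOpen O) (hx : x ∈ O) : ∃ U, Φ.IsBlock U ∧ x ∈ U ∧ U ⊆ O := by
  obtain ⟨W, hW, hxW, hWO⟩ := compact_exists_isClopen_in_isOpen hO hx
  obtain ⟨δ, hδ, hcode⟩ := hΦ.exists_pos_forall_sameCode hW
  refine ⟨{w | Φ.SameCode W x w}, ⟨⟨?_, ?_⟩, ⟨x, .refl Φ W x⟩, ?_, ?_, ?_⟩, .refl Φ W x,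
    fun w hw => hWO (hw.mem hxW)⟩
  · refine isOpen_compl_iff.1 (Metric.isOpen_iff.2 fun w hw => ⟨δ, hδ, fun w' hw' h => hw ?_⟩)
    exact SameCode.trans h (hcode _ _ hw')
  · refine Metric.isOpen_iff.2 fun w hw => ⟨δ, hδ, fun w' hw' => ?_⟩
    exact SameCode.trans hw (hcode _ _ (dist_comm w w' ▸ hw'))
  · obtain ⟨i, hi⟩ := Φ.exists_mem_T x
    exact ⟨i, fun w hw => hw.mem_T hi⟩
  · intro i j p w hp hw hwp _ w' hw'
    exact ((hw.symm.trans hw') i j p hp).1.1 hwp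
  · have key : ∀ i j p, Φ.IsPath i j p → ∀ w, Φ.SameCode W x w → w ∈ p.source →
        Φ.SameCode W x (p w) → ∀ w', Φ.SameCode W x w' →
          w' ∈ p.source ∧ Φ.SameCode W x (p w') := by
      intro i j p hp w hw hwp hpw w' hw'
      have h := hw.symm.trans hw'
      exact ⟨(h i j p hp).1.1 hwp, hpw.trans (h.map hp hwp)⟩
    intro i j p w hp hw hwp hpw
    apply Subset.antisymm
    · rintro _ ⟨w', hw', rfl⟩
      exact (key i j p hp w hw hwp hpw w' hw').2
    · intro y hy
      obtain ⟨q, hq, hqp⟩ := hp.exists_symm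
      have hqs : q.source = p.target := hqp.source_eq
      have hpq : p w ∈ q.source := hqs ▸ p.map_source hwp
      have hqw : q (p w) = w := by rw [hqp.eqOn hpq]; exact p.left_inv hwp
      have := key j i q hq (p w) hpw hpq (by rwa [hqw]) y hy
      rw [hqp.eqOn this.1, hqs] at this
      exact ⟨_, this.2, p.right_inv this.1⟩

end SmallBlocks

end PseudogroupAction

/-! ### Arzelà–Ascoli for homeomorphisms. -/

theorem Homeomorph.exists_subseq_tendstoUniformly {Y : Type*} [MetricSpace Y] [CompactSpace Y]
    (h : ℕ → Y ≃ₜ Y) (heq : UniformEquicontinuous fun n => (h n : Y → Y))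
    (heq' : UniformEquicontinuous fun n => ((h n).symm : Y → Y)) :
    ∃ (φ : ℕ → ℕ) (a : Y ≃ₜ Y), StrictMono φ ∧
      TendstoUniformly (fun n => (h (φ n) : Y → Y)) a atTop := by
  have key : ∀ k : ℕ → Y ≃ₜ Y, UniformEquicontinuous (fun n => (k n : Y → Y)) →
      ∃ (φ : ℕ → ℕ) (a : C(Y, Y)), StrictMono φ ∧
        TendstoUniformly (fun n => (k (φ n) : Y → Y)) a atTop := by
    intro k hk
    let K : ℕ → BoundedContinuousFunction Y Y := fun n =>
      BoundedContinuousFunction.mkOfCompact (k n : C(Y, Y))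
    have hc : IsCompact (closure (range K)) := by
      refine BoundedContinuousFunction.arzela_ascoli univ isCompact_univ _
        (fun _ _ _ => mem_univ _) fun x => ?_
      intro U hU
      filter_upwards [hk.equicontinuous x U hU] with y hy
      rintro ⟨_, n, rfl⟩
      exact hy n
    obtain ⟨a, -, φ, hφ, ha⟩ := hc.tendsto_subseq (x := K) fun n => subset_closure (mem_range_self n)
    exact ⟨φ, a.toContinuousMap, hφ, BoundedContinuousFunction.tendsto_iff_tendstoUniformly.1 ha⟩
  obtain ⟨φ, a, hφ, ha⟩ := key h heq
  -- A further subsequence makes the inverses converge too; the two limits are mutually inverse.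
  obtain ⟨ψ, b, hψ, hb⟩ := key (fun n => (h (φ n)).symm) (heq'.comp φ)
  have ha' : TendstoUniformly (fun n => (h (φ (ψ n)) : Y → Y)) a atTop :=
    fun U hU => hψ.tendsto_atTop.eventually (ha U hU)
  refine ⟨φ ∘ ψ, ⟨⟨a, b, fun y => ?_, fun y => ?_⟩, a.continuous, b.continuous⟩, hφ.comp hψ, ha'⟩
  · have := hb.tendsto_comp b.continuous.continuousAt (ha'.tendsto_at y)
    exact tendsto_nhds_unique (this.congr fun n => (h (φ (ψ n))).symm_apply_apply y)
      tendsto_const_nhds |>.symm ▸ rfl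
  · have := ha'.tendsto_comp a.continuous.continuousAt (hb.tendsto_at y)
    exact tendsto_nhds_unique (this.congr fun n => (h (φ (ψ n))).apply_symm_apply y)
      tendsto_const_nhds |>.symm ▸ rfl

namespace PseudogroupAction

section Topological

variable {X : Type*} [TopologicalSpace X] {Φ : PseudogroupAction X}

theorem IsAdapted.exists_mem_induced {U : Set X} {H : Subgroup (U ≃ₜ U)} (hU : Φ.IsAdapted U H)
    {h : U ≃ₜ U} (hh : h ∈ H) : ∃ g ∈ Φ.induced U, g.source = U ∧ ∀ x : U, g x = h x := by
  have : Nonempty U := hU.2.1.to_subtype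
  let e : OpenPartialHomeomorph U X :=
    hU.1.isOpen.isOpenEmbedding_subtypeVal.toOpenPartialHomeomorph Subtype.val
  have het : e.target = U := by simp [e]
  have hes : e.source = univ := by simp [e]
  have he : ∀ u : U, e.symm u = u := fun u => e.left_inv (hes ▸ mem_univ u)
  let g : OpenPartialHomeomorph X X := e.symm.trans (h.toOpenPartialHomeomorph.trans e)
  have hgs : g.source = U := by
    simp [g, het, hes]
  have hgh : ∀ x : U, g x = h x := fun x => by
    change e (h (e.symm x)) = h x
    rw [he]
    rfl
  exact ⟨g, (hU.2.2 g).2 ⟨hgs.subset, h, hh, fun x hx => hgh ⟨x, hgs ▸ hx⟩⟩, hgs, hgh⟩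

theorem induced_mono {U U' : Set X} (h : U ⊆ U') : Φ.induced U ⊆ Φ.induced U' :=
  fun _ hg => ⟨hg.1, hg.2.1.trans h, hg.2.2.trans h⟩

theorem ReturnEquivalent.symm {X' : Type*} [TopologicalSpace X'] {Φ' : PseudogroupAction X'}
    (h : Φ.ReturnEquivalent Φ') : Φ'.ReturnEquivalent Φ := by
  obtain ⟨φ, ⟨x, hx⟩, h₁, h₂⟩ := h
  exact ⟨φ.symm, ⟨φ x, φ.map_source hx⟩, h₂, h₁⟩

end Topological

/-! ### Stability, LCSQA and local rigidity are equivalent. -/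

section Metric

variable {X : Type*} [MetricSpace X] {Φ : PseudogroupAction X}

/-- A quantitative form of strong quasi-analyticity on `U`, which involves no closure: an element of
`𝒢*_U` that is uniformly close to the identity on a nonempty open set is uniformly close to the
identity on its domain. -/
def IsRigidOn (Φ : PseudogroupAction X) (U : Set X) : Prop :=
  ∀ V, IsOpen V → V.Nonempty → V ⊆ U → ∀ ε > 0, ∃ δ > 0, ∀ g ∈ Φ.induced U, V ⊆ g.source →
    (∀ v ∈ V, dist (g v) v < δ) → ∀ u ∈ g.source, dist (g u) u < ε

/-- Every point has an open neighborhood on which the action is rigid. -/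
def IsLocallyRigid (Φ : PseudogroupAction X) : Prop :=
  ∀ x, ∃ U, IsOpen U ∧ x ∈ U ∧ Φ.IsRigidOn U

theorem IsRigidOn.mono {U U' : Set X} (hU : Φ.IsRigidOn U) (h : U' ⊆ U) : Φ.IsRigidOn U' := by
  intro V hV hVn hVU ε hε
  obtain ⟨δ, hδ, hg⟩ := hU V hV hVn (hVU.trans h) ε hε
  exact ⟨δ, hδ, fun g hgU => hg g (induced_mono h hgU)⟩

theorem IsAdapted.exists_pos_forall_dist_lt {U : Set X} {H : Subgroup (U ≃ₜ U)}
    (hU : Φ.IsAdapted U H) (hΦ : Φ.IsEquicontinuous) {ε : ℝ} (hε : 0 < ε) :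
    ∃ δ > 0, ∀ h ∈ H, ∀ u u' : U, dist u u' < δ → dist (h u) (h u') < ε := by
  obtain ⟨δ, hδ, heq⟩ := hΦ ε hε
  refine ⟨δ, hδ, fun h hh u u' hd => ?_⟩
  obtain ⟨g, hg, hgs, hgh⟩ := hU.exists_mem_induced hh
  rw [Subtype.dist_eq, ← hgh, ← hgh]
  exact heq g hg.1 u (hgs ▸ u.2) u' (hgs ▸ u'.2) hd

theorem IsBlock.mem_setStabilizer {U V : Set X} {H : Subgroup (U ≃ₜ U)} (hV : Φ.IsBlock V)
    (hVU : V ⊆ U) {h : U ≃ₜ U} (hh : h ∈ H) {g : OpenPartialHomeomorph X X}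
    (hg : g ∈ Φ.pseudoStar) (hVg : V ⊆ g.source) (hgh : ∀ x (hx : x ∈ V), g x = h ⟨x, hVU hx⟩)
    {w : X} (hw : w ∈ V) (hgw : g w ∈ V) : h ∈ setStabilizer H V := by
  obtain ⟨i, j, p, hp, -, hs, he⟩ := mem_pseudoStar_iff.1 hg
  have himage := hV.image_eq hp hw (hs (hVg hw)) (he (hVg hw) ▸ hgw)
  refine ⟨hh, Subset.antisymm ?_ fun y hy => ?_⟩
  · rintro _ ⟨u, hu, rfl⟩
    change (h u : X) ∈ V
    rw [← hgh u hu, he (hVg hu), ← himage]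
    exact mem_image_of_mem p hu
  · change (y : X) ∈ V at hy
    rw [← himage] at hy
    obtain ⟨v, hv, hvy⟩ := hy
    exact ⟨⟨v, hVU hv⟩, hv, Subtype.ext ((hgh v hv).symm.trans ((he (hVg hv)).trans hvy))⟩

/-- If rigidity fails, there are elements of `H` tending to the identity on `V` but each moving some
point by at least `ε`. A uniform limit is the identity on a block inside `V`, hence everywhere by
stability, a contradiction. -/
theorem IsStable.isLocallyRigid [CompactSpace X] [TotallyDisconnectedSpace X] (hs : Φ.IsStable)
    (hΦ : Φ.IsEquicontinuous) : Φ.IsLocallyRigid := by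
  intro x
  obtain ⟨U, H, hU, hxU, hstab⟩ := hs x
  refine ⟨U, hU.1.isOpen, hxU, fun V hV ⟨v, hv⟩ hVU ε hε => ?_⟩
  by_contra! hcon
  obtain ⟨B, hB, hvB, hBV⟩ := hΦ.exists_isBlock hV hv
  have hBU := hBV.trans hVU
  obtain ⟨r, hr, hBr⟩ := exists_pos_forall_dist_lt_mem hB.isClopen
  -- The bound `r` makes each `g n` return `v` to `B`, hence preserve `B`; the bound `1 / (n + 1)`
  -- makes the limit the identity on `B`.
  choose g hg hVg hgV u hu hgu using fun n : ℕ =>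
    hcon (min r (1 / (n + 1))) (lt_min hr Nat.one_div_pos_of_nat)
  choose hgs h hh hgh using fun n => (hU.2.2 (g n)).1 (hg n)
  have hstabilizer : ∀ n, h n ∈ setStabilizer H B := fun n =>
    hB.mem_setStabilizer hBU (hh n) (hg n).1 (hBV.trans (hVg n))
      (fun x hx => hgh n x (hVg n (hBV hx))) hvB
      (hBr v hvB _ (dist_comm (g n v) v ▸ (hgV n v hv).trans_le (min_le_left _ _)))
  have : CompactSpace U := isCompact_iff_compactSpace.1 hU.1.isClosed.isCompact
  have hequi : ∀ k : ℕ → U ≃ₜ U, (∀ n, k n ∈ H) →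
      UniformEquicontinuous fun n => (k n : U → U) := by
    intro k hk
    rw [Metric.uniformEquicontinuous_iff]
    intro ε hε
    obtain ⟨δ, hδ, hHδ⟩ := hU.exists_pos_forall_dist_lt hΦ hε
    exact ⟨δ, hδ, fun u u' hd n => hHδ _ (hk n) u u' hd⟩
  obtain ⟨φ, a, hφ, ha⟩ := Homeomorph.exists_subseq_tendstoUniformly h (hequi h hh)
    (hequi (fun n => (h n)⁻¹) fun n => inv_mem (hh n))
  have ha1 : a = 1 := by
    refine hstab B hB.group hB.isAdapted hBU a (fun ε hε => ?_) fun y hy => ?_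
    · obtain ⟨n, hn⟩ := (Metric.tendstoUniformly_iff.1 ha ε hε).exists
      exact ⟨_, hstabilizer _, hn⟩
    · refine tendsto_nhds_unique (ha.tendsto_at y) (tendsto_iff_dist_tendsto_zero.2 ?_)
      refine squeeze_zero (fun _ => dist_nonneg) (fun n => ?_)
        (tendsto_one_div_add_atTop_nhds_zero_nat.comp hφ.tendsto_atTop)
      have := (hgV (φ n) y (hBV hy)).le.trans (min_le_right _ _)
      rwa [hgh (φ n) y (hVg _ (hBV hy))] at this
  obtain ⟨n, hn⟩ := (Metric.tendstoUniformly_iff.1 ha ε hε).exists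
  have h1 := hn ⟨u (φ n), hgs _ (hu _)⟩
  have h2 := hgu (φ n)
  rw [hgh (φ n) _ (hu _)] at h2
  rw [ha1, dist_comm, Subtype.dist_eq] at h1
  exact absurd h1 (not_lt.2 h2)

theorem IsLocallyRigid.isLCSQA [LocallyCompactSpace X] (h : Φ.IsLocallyRigid) : Φ.IsLCSQA := by
  intro x
  obtain ⟨U, hUo, hxU, hU⟩ := h x
  refine ⟨U, hUo, hxU, ?_⟩
  rintro O hO f hf ⟨V, hV, ⟨v, hv⟩, hVOU, hfV⟩ y
  obtain ⟨K, hK, hvK, hKV⟩ := exists_compact_subset hV hv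
  refine eq_of_forall_dist_le fun ε hε => ?_
  obtain ⟨δ, hδ, hg⟩ := hU (interior K) isOpen_interior ⟨v, hvK⟩
    (interior_subset.trans (hKV.trans fun z hz => (hVOU hz).2)) (ε / 2) (half_pos hε)
  have hKO : K ⊆ O := hKV.trans fun z hz => (hVOU hz).1
  -- Closeness on this compact set controls an approximant both on `K`, where rigidity is tested,
  -- and at `y`, where the conclusion is wanted.
  have hK' : IsCompact ((↑) ⁻¹' K ∪ {y} : Set O) := by
    refine IsCompact.union ?_ isCompact_singleton
    rw [Subtype.isCompact_iff, Subtype.image_preimage_coe, inter_eq_right.2 hKO]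
    exact hK
  have hnear : ∀ᶠ k in 𝓝 f, ∀ z ∈ ((↑) ⁻¹' K ∪ {y} : Set O),
      dist (f z) (k z) < min δ (ε / 2) :=
    Metric.tendstoUniformlyOn_iff.1
      (ContinuousMap.tendsto_iff_forall_isCompact_tendstoUniformlyOn.1 tendsto_id _ hK') _
      (lt_min hδ (half_pos hε))
  obtain ⟨k, ⟨g, hgU, hgO, hkg⟩, hk⟩ := ((mem_closure_iff_frequently.1 hf).and_eventually hnear).exists
  have hgy := hg g hgU (interior_subset.trans (hKO.trans hgO.ge)) (fun z hz => by
    have hzK := interior_subset hz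
    have := (hk ⟨z, hKO hzK⟩ (.inl hzK)).trans_le (min_le_left _ _)
    rwa [hfV _ (hKV hzK), hkg, dist_comm] at this) y (hgO.ge y.2)
  have hfy := (hk y (.inr rfl)).trans_le (min_le_right _ _)
  rw [hkg] at hfy
  linarith [dist_triangle (f y) (g y) y]

/-- On a compact block `B` the compact-open topology is the uniform one, so an element of the
closure of `H_{B,V}` is a limit to which LCSQA applies with `O = B`. -/
theorem IsLCSQA.isStable [CompactSpace X] [TotallyDisconnectedSpace X] (h : Φ.IsLCSQA)
    (hΦ : Φ.IsEquicontinuous) : Φ.IsStable := by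
  intro x
  obtain ⟨U, hUo, hxU, hU⟩ := h x
  obtain ⟨B, hB, hxB, hBU⟩ := hΦ.exists_isBlock hUo hxU
  refine ⟨B, hB.group, hB.isAdapted, hxB, fun V HV hV hVB g hg hgV => ?_⟩
  have : CompactSpace B := isCompact_iff_compactSpace.1 hB.isClopen.isClosed.isCompact
  let f : C(B, X) := ⟨fun u => g u, by fun_prop⟩
  have hf : f ∈ Φ.inducedClosure U B := by
    refine Metric.mem_closure_iff.2 fun ε hε => ?_
    obtain ⟨k, ⟨hk, -⟩, hgk⟩ := hg ε hε
    obtain ⟨e, heB, hes, hek⟩ := hB.isAdapted.exists_mem_induced hk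
    exact ⟨⟨fun u => k u, by fun_prop⟩, ⟨e, induced_mono hBU heB, hes, fun u => (hek u).symm⟩,
      (ContinuousMap.dist_lt_iff hε).2 hgk⟩
  have := hU B hB.isClopen.isOpen f hf ⟨V, hV.1.isOpen, hV.2.1,
    subset_inter hVB (hVB.trans hBU), fun y hy => congrArg Subtype.val (hgV y hy)⟩
  exact Homeomorph.ext fun u => Subtype.ext (this u)

end Metric

/-! ### Local rigidity under return equivalence. -/

section Transport

variable {X₁ X₂ : Type*} [MetricSpace X₁] [MetricSpace X₂] {Φ₁ : PseudogroupAction X₁}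
  {Φ₂ : PseudogroupAction X₂}

/-- Compactness of `K` makes `φ` and its inverse uniformly continuous there, so smallness of
displacements passes through conjugation in both directions. -/
theorem IsRigidOn.image {K : Set X₁} (hK : Φ₁.IsRigidOn K) (hKc : IsCompact K)
    (φ : OpenPartialHomeomorph X₁ X₂) (hKφ : K ⊆ φ.source)
    (hφ : ∀ h ∈ Φ₂.induced (φ '' K), (φ.trans h).trans φ.symm ∈ Φ₁.pseudoStar) :
    Φ₂.IsRigidOn (φ '' K) := by
  intro V hV hVn hVK ε hε
  have hVt : V ⊆ φ.target := hVK.trans ((image_mono hKφ).trans φ.image_source_eq_target.subset)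
  have huc : UniformContinuousOn φ K :=
    hKc.uniformContinuousOn_of_continuous (φ.continuousOn.mono hKφ)
  have hut : φ '' K ⊆ φ.target := (image_mono hKφ).trans φ.image_source_eq_target.subset
  have huc' : UniformContinuousOn φ.symm (φ '' K) :=
    (hKc.image_of_continuousOn (φ.continuousOn.mono hKφ)).uniformContinuousOn_of_continuous
      (φ.continuousOn_symm.mono hut)
  have hsymm : ∀ y ∈ φ '' K, φ.symm y ∈ K := by
    rintro _ ⟨x, hx, rfl⟩
    rwa [φ.left_inv (hKφ hx)]
  obtain ⟨ε', hε', hφε⟩ := Metric.uniformContinuousOn_iff.1 huc ε hε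
  obtain ⟨δ', hδ', hrigid⟩ := hK (φ.symm '' V) (φ.isOpen_image_symm_of_subset_target hV hVt)
    (hVn.image _) (by rintro _ ⟨y, hy, rfl⟩; exact hsymm y (hVK hy)) ε' hε'
  obtain ⟨δ, hδ, hφδ⟩ := Metric.uniformContinuousOn_iff.1 huc' δ' hδ'
  refine ⟨δ, hδ, fun g hg hVg hgV u hu => ?_⟩
  have hgK : ∀ y ∈ g.source, g y ∈ φ '' K := fun y hy => hg.2.2 (g.map_source hy)
  have hmem : ∀ y ∈ g.source, φ.symm y ∈ ((φ.trans g).trans φ.symm).source := by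
    intro y hy
    have hy' := φ.right_inv (hut (hg.2.1 hy))
    refine ⟨⟨φ.map_target (hut (hg.2.1 hy)), ?_⟩, ?_⟩
    · change φ (φ.symm y) ∈ g.source
      rwa [hy']
    · change g (φ (φ.symm y)) ∈ φ.target
      rw [hy']
      exact hut (hgK y hy)
  have happ : ∀ y ∈ g.source, ((φ.trans g).trans φ.symm) (φ.symm y) = φ.symm (g y) := by
    intro y hy
    change φ.symm (g (φ (φ.symm y))) = _
    rw [φ.right_inv (hut (hg.2.1 hy))]
  have hsource : ((φ.trans g).trans φ.symm).source ⊆ K := fun x hx => by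
    rw [← φ.left_inv hx.1.1]
    exact hsymm _ (hg.2.1 hx.1.2)
  have htarget : ((φ.trans g).trans φ.symm).target ⊆ K := by
    rw [← OpenPartialHomeomorph.image_source_eq_target]
    rintro _ ⟨x, hx, rfl⟩
    exact hsymm _ (hgK _ hx.1.2)
  have := hrigid _ ⟨hφ g hg, hsource, htarget⟩
    (by rintro _ ⟨y, hy, rfl⟩; exact hmem y (hVg hy))
    (by
      rintro _ ⟨y, hy, rfl⟩
      rw [happ y (hVg hy)]
      exact hφδ _ (hgK y (hVg hy)) _ (hVK hy) (hgV y hy)) _ (hmem u hu)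
  rw [happ u hu] at this
  have := hφε _ (hsymm _ (hgK u hu)) _ (hsymm _ (hg.2.1 hu)) this
  rwa [φ.right_inv (hut (hgK u hu)), φ.right_inv (hut (hg.2.1 hu))] at this

/-- Minimality gives `g` in `𝒢*` taking `y` into the target of `φ`; then `φ` followed by `g.symm` is
a chart around `y` through which rigidity is pushed. -/
theorem IsLocallyRigid.of_returnEquivalent [LocallyCompactSpace X₁] (h : Φ₁.IsLocallyRigid)
    (hret : Φ₁.ReturnEquivalent Φ₂) (hmin : Φ₂.IsMinimal) : Φ₂.IsLocallyRigid := by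
  intro y
  obtain ⟨φ, ⟨x₀, hx₀⟩, -, hφ⟩ := hret
  obtain ⟨_, hgy, g, hg, hy, rfl⟩ :=
    (hmin y).inter_open_nonempty _ φ.open_target ⟨_, φ.map_source hx₀⟩
  obtain ⟨U, hUo, hxU, hU⟩ := h (φ.symm (g y))
  have hxφ : φ.symm (g y) ∈ (φ.trans g.symm).source := by
    refine ⟨φ.map_target hgy, ?_⟩
    change φ (φ.symm (g y)) ∈ g.target
    rw [φ.right_inv hgy]
    exact g.map_source hy
  obtain ⟨K, hK, hxK, hKU⟩ := exists_compact_subset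
    (hUo.inter (φ.trans g.symm).open_source) ⟨hxU, hxφ⟩
  have hKs : K ⊆ (φ.trans g.symm).source := fun z hz => (hKU hz).2
  have hrigid := (hU.mono fun z hz => (hKU hz).1).image (Φ₂ := Φ₂) hK (φ.trans g.symm) hKs
    (fun k hk => ?_)
  · refine ⟨(φ.trans g.symm) '' interior K,
      (φ.trans g.symm).isOpen_image_of_subset_source isOpen_interior (interior_subset.trans hKs),
      ⟨_, hxK, ?_⟩, hrigid.mono (image_mono interior_subset)⟩
    change g.symm (φ (φ.symm (g y))) = y
    rw [φ.right_inv hgy, g.left_inv hy]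
  -- Conjugating by the chart means conjugating by `g`, which stays in `𝒢*` of `Φ₂` and lands in the
  -- target of `φ`, and then by `φ`.
  · have hconj : (g.symm.trans k).trans g ∈ Φ₂.induced φ.target := by
      have hKt : (φ.trans g.symm) '' K ⊆ g.source ∩ g ⁻¹' φ.target := by
        rintro _ ⟨z, hz, rfl⟩
        refine ⟨g.map_target (hKs hz).2, ?_⟩
        change g (g.symm (φ z)) ∈ φ.target
        rw [show g (g.symm (φ z)) = φ z from g.right_inv (hKs hz).2]
        exact φ.map_source (hKs hz).1
      refine ⟨trans_mem_pseudoStar (trans_mem_pseudoStar (symm_mem_pseudoStar hg) hk.1) hg,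
        fun z hz => ?_, ?_⟩
      · rw [← g.right_inv hz.1.1]
        exact (hKt (hk.2.1 hz.1.2)).2
      · rw [← OpenPartialHomeomorph.image_source_eq_target]
        rintro _ ⟨z, hz, rfl⟩
        exact (hKt (hk.2.2 (k.map_source hz.1.2))).2
    have := (hφ _ hconj).1
    simpa only [OpenPartialHomeomorph.trans_symm_eq_symm_trans_symm,
      OpenPartialHomeomorph.symm_symm, OpenPartialHomeomorph.trans_assoc] using this

end Transport

end PseudogroupAction

theorem proposition3p10
    {X₁ : Type*} [MetricSpace X₁] [CompactSpace X₁] [TotallyDisconnectedSpace X₁]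
    [PerfectSpace X₁] [Nonempty X₁]
    {X₂ : Type*} [MetricSpace X₂] [CompactSpace X₂] [TotallyDisconnectedSpace X₂]
    [PerfectSpace X₂] [Nonempty X₂]
    (Φ₁ : PseudogroupAction X₁) (Φ₂ : PseudogroupAction X₂)
    (hmin₁ : Φ₁.IsMinimal) (hmin₂ : Φ₂.IsMinimal)
    (heq₁ : Φ₁.IsEquicontinuous) (heq₂ : Φ₂.IsEquicontinuous)
    (hret : Φ₁.ReturnEquivalent Φ₂) :
    (Φ₁.IsStable ↔ Φ₂.IsStable) ∧ (Φ₁.IsLCSQA ↔ Φ₂.IsLCSQA) ∧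
      (Φ₁.IsStable ↔ Φ₁.IsLCSQA) ∧ (Φ₂.IsStable ↔ Φ₂.IsLCSQA) := by
  have hs₁ : Φ₁.IsStable ↔ Φ₁.IsLocallyRigid :=
    ⟨fun h => h.isLocallyRigid heq₁, fun h => h.isLCSQA.isStable heq₁⟩
  have hs₂ : Φ₂.IsStable ↔ Φ₂.IsLocallyRigid :=
    ⟨fun h => h.isLocallyRigid heq₂, fun h => h.isLCSQA.isStable heq₂⟩
  have hl₁ : Φ₁.IsLCSQA ↔ Φ₁.IsLocallyRigid :=
    ⟨fun h => (h.isStable heq₁).isLocallyRigid heq₁, fun h => h.isLCSQA⟩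
  have hl₂ : Φ₂.IsLCSQA ↔ Φ₂.IsLocallyRigid :=
    ⟨fun h => (h.isStable heq₂).isLocallyRigid heq₂, fun h => h.isLCSQA⟩
  have hr : Φ₁.IsLocallyRigid ↔ Φ₂.IsLocallyRigid :=
    ⟨fun h => h.of_returnEquivalent hret hmin₂, fun h => h.of_returnEquivalent hret.symm hmin₁⟩
  exact ⟨hs₁.trans (hr.trans hs₂.symm), hl₁.trans (hr.trans hl₂.symm), hs₁.trans hl₁.symm,
    hs₂.trans hl₂.symm⟩
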